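/- Let $\xi_1,\xi_2,\dots$ be i.i.d. random vectors in $\mathbb{R}^d$ with $E\|\xi_1\|^2<\infty$, mean $0$ and identity covariance matrix. For $n\ge 1$ let $P_n$ be the distribution of $n^{-1/2}\sum_{k=1}^n\xi_k$, and let $[P_n]^{ac}$ denote the absolutely continuous component of $P_n$ in its Lebesgue decomposition with respect to Lebesgue measure on $\mathbb{R}^d$. The following statements are equivalent. 1. There exists $n_0\ge 1$ such that $[P_{n_0}]^{ac}$ is not the zero measure. 2. For every $n\ge 1$ there is a decomposition $P_n=Q_n+R_n$ into non-negative measures such that (2i) $Q_n(dy)=q_n(y)\,dy$ with a non-negative measurable function $q_n$, and $\sup_{y\in\mathbb{R}^d}\left|q_n(y)-(2\pi)^{-d/2}e^{-\|y\|^2/2}\right|\to 0$ as $n\to\infty$; (2ii) there exist constants $D,\rho>0$, not depending on $n$, such that $R_n(\mathbb{R}^d)\le De^{-\rho n}$ for all $n\ge 1$. -/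

import Mathlib

open MeasureTheory ProbabilityTheory Filter Topology

/-- The law of the normalized sum `n^{-1/2} (ξ_1 + ⋯ + ξ_n)`; the sequence is indexed from `0`,
so the first `n` vectors are `ξ 0, …, ξ (n - 1)`. Only `n ≥ 1` is meaningful. -/
noncomputable def normalizedSumLaw {d : ℕ} {Ω : Type*} [MeasurableSpace Ω]
    (μ : Measure Ω) (ξ : ℕ → Ω → EuclideanSpace ℝ (Fin d)) (n : ℕ) :
    Measure (EuclideanSpace ℝ (Fin d)) :=
  μ.map (fun ω => (√(n : ℝ))⁻¹ • ∑ k ∈ Finset.range n, ξ k ω)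

/-- The absolutely continuous component of a (finite) measure in its Lebesgue decomposition
with respect to Lebesgue measure on `ℝ^d`. -/
noncomputable def acComponent {d : ℕ} (μ : Measure (EuclideanSpace ℝ (Fin d))) :
    Measure (EuclideanSpace ℝ (Fin d)) :=
  (volume : Measure (EuclideanSpace ℝ (Fin d))).withDensity (μ.rnDeriv volume)

/-- The standard normal density `(2π)^{-d/2} exp(-‖y‖²/2)` on `ℝ^d`. -/
noncomputable def stdNormalDensity {d : ℕ} (y : EuclideanSpace ℝ (Fin d)) : ℝ :=
  (2 * Real.pi) ^ (-((d : ℝ) / 2)) * Real.exp (-(‖y‖ ^ 2 / 2))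

/-- The sequence of measures `P 1, P 2, …` satisfies the truncated local limit theorem:
`P n = Q n + R n` with non-negative measures `Q n`, `R n`, where `Q n` has a density `q n` that
converges to the standard normal density uniformly on `ℝ^d`, and the total mass of `R n` is at
most `D e^{-ρ n}`. -/
def TruncatedLocalLimit {d : ℕ} (P : ℕ → Measure (EuclideanSpace ℝ (Fin d))) : Prop :=
  ∃ (Q R : ℕ → Measure (EuclideanSpace ℝ (Fin d))) (q : ℕ → EuclideanSpace ℝ (Fin d) → ℝ),
    (∀ n, 1 ≤ n → P n = Q n + R n) ∧
    (∀ n, 1 ≤ n → Measurable (q n) ∧ (∀ y, 0 ≤ q n y) ∧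
      Q n = (volume : Measure (EuclideanSpace ℝ (Fin d))).withDensity
        (fun y => ENNReal.ofReal (q n y))) ∧
    TendstoUniformly q stdNormalDensity atTop ∧
    ∃ D ρ : ℝ, 0 < D ∧ 0 < ρ ∧
      ∀ n, 1 ≤ n → R n Set.univ ≤ ENNReal.ofReal (D * Real.exp (-(ρ * n)))

/-! ### From an absolutely continuous component to a smooth bump below a convolution square. -/

section SmoothPart

open scoped ENNReal ContDiff symmDiff

/-! Write `L n` for the law of the unnormalized sum. If some `L n₀` has an absolutely continuous
part, it dominates a multiple of Lebesgue measure on a set of positive measure. Convolving with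
itself regularizes this: `L N` with `N = 2 n₀` dominates a measure `G` with smooth, compactly
supported density `g` (`exists_contDiff_withDensity_le_conv`).

Put `W = L N - G`, of mass below 1. In the `m`-fold convolution power of `G + W`, the term without
any factor `G` is the power of `W`, of exponentially small mass; it becomes the remainder.
Everything else has the form `B ∗ G` (`exists_conv_decomposition`), so it has a density with an
integrable characteristic function.

Since sup norms of densities are bounded by L¹ norms of characteristic functions
(`norm_convDensity_sub_stdNormalDensity_le`), it remains to prove L¹ convergence to the Gaussian.
Near the origin this is the classical central limit argument; away from it, the characteristic
function of `G` is uniformly below its mass and rapidly decreasing (`exists_norm_charFun_bump_le`,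
`charFun_bump_decay`). Both regimes meet in `tendsto_integral_norm_sub_gaussian`.

Conversely, uniform closeness to a positive continuous density makes some `Q n` nonzero, and it lies
below `P n`. -/

theorem exists_smul_restrict_le_withDensity {α : Type*} [MeasurableSpace α] {μ : Measure α}
    [SigmaFinite μ] {f : α → ℝ≥0∞} (hf : Measurable f) (h : μ.withDensity f ≠ 0) :
    ∃ (A : Set α) (c : ℝ≥0∞), MeasurableSet A ∧ μ A ≠ 0 ∧ μ A ≠ ⊤ ∧ c ≠ 0 ∧ c ≠ ⊤ ∧
      c • μ.restrict A ≤ μ.withDensity f := by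
  -- The countably many superlevel sets exhaust the set where `f` is nonzero, so one has positive
  -- measure; σ-finiteness then cuts it down to finite measure.
  obtain ⟨n, hn⟩ : ∃ n : ℕ, μ {x | ((n : ℝ≥0∞) + 1)⁻¹ ≤ f x} ≠ 0 := by
    by_contra! H
    refine h ((withDensity_eq_zero_iff hf.aemeasurable).2 ?_)
    have hU : μ (⋃ n : ℕ, {x | ((n : ℝ≥0∞) + 1)⁻¹ ≤ f x}) = 0 := measure_iUnion_null H
    refine measure_mono_null (fun x hx => ?_) hU
    obtain ⟨n, hn⟩ := ENNReal.exists_inv_nat_lt (a := f x) hx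
    refine Set.mem_iUnion.2 ⟨n, le_trans ?_ hn.le⟩
    gcongr
    exact le_self_add
  obtain ⟨A, hA, hAs, h0, htop⟩ := Measure.exists_subset_measure_lt_top (μ := μ)
    (measurableSet_le measurable_const hf) (pos_iff_ne_zero.2 hn)
  refine ⟨A, ((n : ℝ≥0∞) + 1)⁻¹, hA, h0.ne', htop.ne, by simp, by simp, ?_⟩
  rw [← withDensity_const, ← withDensity_indicator hA]
  exact withDensity_mono (ae_of_all _ (Set.indicator_le fun x hx => hAs hx))

variable {E : Type*} [NormedAddCommGroup E] [InnerProductSpace ℝ E] [FiniteDimensional ℝ E]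
  [MeasurableSpace E] [BorelSpace E]

theorem map_smul_restrict {r : ℝ} (hr : r ≠ 0) (A : Set E) :
    ((volume : Measure E).restrict A).map (fun x => r • x) =
      ENNReal.ofReal |(r ^ Module.finrank ℝ E)⁻¹| •
        (volume : Measure E).restrict ((fun x => r⁻¹ • x) ⁻¹' A) := by
  have he : MeasurableEmbedding (fun x : E => r • x) :=
    (Homeomorph.smulOfNeZero r hr).measurableEmbedding
  have hA : A = (fun x : E => r • x) ⁻¹' ((fun x => r⁻¹ • x) ⁻¹' A) := by
    ext x; simp [smul_smul, inv_mul_cancel₀ hr]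
  conv_lhs => rw [hA]
  rw [← he.restrict_map, Measure.map_addHaar_smul _ hr, Measure.restrict_smul]

theorem restrict_conv_restrict {A : Set E} (hA : MeasurableSet A) (hfin : volume A ≠ ⊤) :
    (volume : Measure E).restrict A ∗ (volume : Measure E).restrict A =
      (volume : Measure E).withDensity (fun z => volume (A ∩ (fun x => z - x) ⁻¹' A)) := by
  have : IsFiniteMeasure ((volume : Measure E).restrict A) := ⟨by simpa using hfin.lt_top⟩
  have hm2 : MeasurableSet {p : E × E | p.2 ∈ A ∧ p.1 - p.2 ∈ A} :=
    (measurable_snd hA).inter ((measurable_fst.sub measurable_snd) hA)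
  ext S hS
  rw [← lintegral_indicator_one hS, Measure.lintegral_conv (measurable_one.indicator hS),
    withDensity_apply _ hS, ← lintegral_indicator hS, ← lintegral_indicator hA]
  have h1 : ∀ x, A.indicator (fun x => ∫⁻ y in A, S.indicator 1 (x + y)) x =
      ∫⁻ z, S.indicator 1 z * Set.indicator {p : E × E | p.2 ∈ A ∧ p.1 - p.2 ∈ A} 1 (z, x) := by
    intro x
    by_cases hx : x ∈ A
    · rw [Set.indicator_of_mem hx, ← lintegral_indicator hA,
        ← lintegral_sub_right_eq_self _ x]
      refine lintegral_congr fun z => ?_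
      by_cases hz : z - x ∈ A <;> simp [hz, hx]
    · simp [hx]
  simp_rw [h1]
  rw [lintegral_lintegral_swap]
  · refine lintegral_congr fun z => ?_
    rw [lintegral_const_mul' _ _ (by by_cases hz : z ∈ S <;> simp [hz])]
    by_cases hz : z ∈ S
    · rw [Set.indicator_of_mem hz, Set.indicator_of_mem hz, Pi.one_apply, one_mul,
        ← lintegral_indicator_one (hA.inter (measurable_const_sub z hA))]
      rfl
    · simp [hz]
  · refine Measurable.aemeasurable ?_
    exact ((measurable_one.indicator hS).comp measurable_snd).mul
      ((measurable_one.indicator hm2).comp measurable_swap)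

/-- A Steinhaus argument. The overlap volume of `A` with `z - A` is a density of the convolution, of
nonzero total mass, hence nonzero at some `z`. Translating a measurable set of finite measure is
continuous in measure, so the overlap keeps half its value near `z`. -/
theorem exists_nhds_smul_restrict_le_conv {A : Set E} (hA : MeasurableSet A)
    (h0 : volume A ≠ 0) (hfin : volume A ≠ ⊤) :
    ∃ (z : E) (U : Set E) (c : ℝ≥0∞), IsOpen U ∧ z ∈ U ∧ c ≠ 0 ∧ c ≠ ⊤ ∧
      c • (volume : Measure E).restrict U ≤
        (volume : Measure E).restrict A ∗ (volume : Measure E).restrict A := by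
  have : IsFiniteMeasure ((volume : Measure E).restrict A) := ⟨by simpa using hfin.lt_top⟩
  have hconv := restrict_conv_restrict hA hfin
  set k : E → ℝ≥0∞ := fun z => volume (A ∩ (fun x => z - x) ⁻¹' A) with hk
  obtain ⟨z, hz⟩ : ∃ z, k z ≠ 0 := by
    by_contra! H
    have h1 := congrArg (fun m => m Set.univ) hconv
    simp only [withDensity_apply _ MeasurableSet.univ, H, lintegral_zero] at h1
    rw [Measure.conv, Measure.map_apply (by fun_prop) MeasurableSet.univ, Set.preimage_univ,
      ← Set.univ_prod_univ, Measure.prod_prod] at h1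
    simp [h0] at h1
  have hzfin : k z ≠ ⊤ := ((measure_mono Set.inter_subset_left).trans_lt hfin.lt_top).ne
  let F : E → C(E, E) := fun w => ⟨fun x => w - x, by fun_prop⟩
  have hF : Continuous F := ContinuousMap.continuous_of_continuous_uncurry _ (by
    simp only [F, Function.uncurry_def, ContinuousMap.coe_mk]; fun_prop)
  have hlim := tendsto_measure_symmDiff_preimage_nhds_zero (μ := (volume : Measure E))
    (ν := volume) (hF.tendsto z)
    (Eventually.of_forall fun w => Measure.measurePreserving_sub_left volume w)
    (Measure.measurePreserving_sub_left volume z) hA.nullMeasurableSet hfin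
  have hev := hlim.eventually_lt_const (u := k z / 2)
    (ENNReal.div_pos hz (by simp))
  obtain ⟨V, hVU, hVo, hzV⟩ := mem_nhds_iff.1 hev
  refine ⟨z, V, k z / 2, hVo, hzV, (ENNReal.div_pos hz (by simp)).ne',
    (ENNReal.div_lt_top hzfin two_ne_zero).ne, ?_⟩
  rw [hconv, ← withDensity_const, ← withDensity_indicator hVo.measurableSet]
  refine withDensity_mono (ae_of_all _ (Set.indicator_le fun w hw => ?_))
  have hw' : volume (((fun x => w - x) ⁻¹' A) ∆ ((fun x => z - x) ⁻¹' A)) < k z / 2 := hVU hw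
  have h1 : k z ≤ k w + volume (((fun x => w - x) ⁻¹' A) ∆ ((fun x => z - x) ⁻¹' A)) := by
    refine (measure_mono ?_).trans (measure_union_le _ _)
    rintro x ⟨hxA, hx⟩
    by_cases h : x ∈ (fun x => w - x) ⁻¹' A
    · exact Or.inl ⟨hxA, h⟩
    · exact Or.inr (Or.inr ⟨hx, h⟩)
  by_contra! hlt
  have h2 := h1.trans_lt (ENNReal.add_lt_add hlt hw')
  rw [ENNReal.add_halves] at h2
  exact lt_irrefl _ h2

theorem exists_contDiff_withDensity_le {U : Set E} (hU : IsOpen U) {z : E} (hz : z ∈ U)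
    {c : ℝ≥0∞} (h0 : c ≠ 0) (hc : c ≠ ⊤) :
    ∃ g : E → ℝ, ContDiff ℝ ∞ g ∧ HasCompactSupport g ∧ (∀ x, 0 ≤ g x) ∧ g z ≠ 0 ∧
      (volume : Measure E).withDensity (fun x => ENNReal.ofReal (g x)) ≤
        c • (volume : Measure E).restrict U := by
  obtain ⟨f, hfU, hfc, hfs, hfr, hfz⟩ :=
    exists_contDiff_tsupport_subset (n := ⊤) (hU.mem_nhds hz)
  have hfI : ∀ x, f x ∈ Set.Icc 0 1 := fun x => hfr (Set.mem_range_self x)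
  have hc' : 0 < c.toReal := ENNReal.toReal_pos h0 hc
  refine ⟨fun x => c.toReal * f x, contDiff_const.mul hfs, hfc.mul_left,
    fun x => mul_nonneg hc'.le (hfI x).1, by simp [hfz, hc'.ne'], ?_⟩
  rw [← withDensity_const, ← withDensity_indicator hU.measurableSet]
  refine withDensity_mono (ae_of_all _ fun x => ?_)
  by_cases hx : x ∈ U
  · rw [Set.indicator_of_mem hx]
    refine ENNReal.ofReal_le_of_le_toReal ?_
    exact mul_le_of_le_one_right hc'.le (hfI x).2
  · have : f x = 0 := by
      by_contra h
      exact hx (hfU (subset_tsupport f h))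
    simp [this]

theorem exists_contDiff_withDensity_le_conv {ν : Measure E} [SFinite ν]
    {A : Set E} {c : ℝ≥0∞} (hA : MeasurableSet A) (hA0 : volume A ≠ 0) (hfin : volume A ≠ ⊤)
    (h0 : c ≠ 0) (hc : c ≠ ⊤) (hle : c • (volume : Measure E).restrict A ≤ ν) :
    ∃ g : E → ℝ, ContDiff ℝ ∞ g ∧ HasCompactSupport g ∧ (∀ x, 0 ≤ g x) ∧ (∃ z, g z ≠ 0) ∧
      (volume : Measure E).withDensity (fun x => ENNReal.ofReal (g x)) ≤ ν ∗ ν := by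
  have : IsFiniteMeasure ((volume : Measure E).restrict A) := ⟨by simpa using hfin.lt_top⟩
  obtain ⟨z, U, b, hU, hz, hb0, hb, hle'⟩ := exists_nhds_smul_restrict_le_conv hA hA0 hfin
  obtain ⟨g, h1, h2, h3, h4, h5⟩ := exists_contDiff_withDensity_le hU hz
    (c := (c * c) * b) (by simp [h0, hb0])
    (ENNReal.mul_ne_top (ENNReal.mul_ne_top hc hc) hb)
  refine ⟨g, h1, h2, h3, ⟨z, h4⟩, h5.trans ?_⟩
  have h6 : (c • (volume : Measure E).restrict A) ∗ (c • (volume : Measure E).restrict A)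
      ≤ ν ∗ ν :=
    Measure.map_mono (Measure.prod_mono hle hle) (by fun_prop)
  refine le_trans ?_ h6
  have h7 : (c • (volume : Measure E).restrict A) ∗ (c • (volume : Measure E).restrict A) =
      (c * c) • ((volume : Measure E).restrict A ∗ (volume : Measure E).restrict A) := by
    simp only [Measure.conv, Measure.prod_smul_left, Measure.prod_smul_right, Measure.map_smul,
      smul_smul]
  rw [h7, ← smul_smul]
  gcongr

end SmoothPart

/-! ### Characteristic functions of bumps: decay, strict bounds, inversion. -/

section BumpFourier

set_option linter.unusedSectionVars false

open scoped ENNReal ContDiff RealInnerProductSpace FourierTransform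
open Complex (I)

variable {E : Type*} [NormedAddCommGroup E] [InnerProductSpace ℝ E] [FiniteDimensional ℝ E]
  [MeasurableSpace E] [BorelSpace E]

/-- The measure with density `g` with respect to Lebesgue measure. -/
noncomputable def measureOfDensity (g : E → ℝ) : Measure E :=
  (volume : Measure E).withDensity fun x => ENNReal.ofReal (g x)

theorem isFiniteMeasure_measureOfDensity {g : E → ℝ} (hg : Integrable g) :
    IsFiniteMeasure (measureOfDensity g) :=
  isFiniteMeasure_withDensity_ofReal hg.2

theorem integral_measureOfDensity {g : E → ℝ} (hm : Measurable g) (h0 : ∀ x, 0 ≤ g x)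
    (f : E → ℂ) : ∫ x, f x ∂(measureOfDensity g) = ∫ x, f x * g x := by
  rw [measureOfDensity, integral_withDensity_eq_integral_toReal_smul (by fun_prop) (by simp)]
  refine integral_congr_ae (ae_of_all _ fun x => ?_)
  simp only [ENNReal.toReal_ofReal (h0 x), Complex.real_smul, mul_comm]

/-- Reconciles the kernels `exp(i⟪x, t⟫)` and `exp(-2πi⟪x, v⟫)`; this is the source of the factor
`-2π` in the inversion formulas. -/
theorem charFun_measureOfDensity_eq_fourier {g : E → ℝ} (hm : Measurable g) (h0 : ∀ x, 0 ≤ g x)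
    (v : E) : charFun (measureOfDensity g) ((-(2 * Real.pi)) • v) = 𝓕 (fun x => (g x : ℂ)) v := by
  rw [charFun_apply, integral_measureOfDensity hm h0, Real.fourier_eq']
  refine integral_congr_ae (ae_of_all _ fun x => ?_)
  simp [inner_smul_right]

/-- A smooth compactly supported real function as a complex Schwartz function. -/
noncomputable def bumpSchwartz {g : E → ℝ} (hs : ContDiff ℝ ∞ g) (hc : HasCompactSupport g) :
    SchwartzMap E ℂ :=
  HasCompactSupport.toSchwartzMap (f := fun x => (g x : ℂ))
    (hc.comp_left (g := fun r : ℝ => (r : ℂ)) Complex.ofReal_zero)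
    (Complex.ofRealCLM.contDiff.comp hs)

theorem charFun_eq_fourier_bumpSchwartz {g : E → ℝ} (hs : ContDiff ℝ ∞ g)
    (hc : HasCompactSupport g) (h0 : ∀ x, 0 ≤ g x) (v : E) :
    charFun (measureOfDensity g) ((-(2 * Real.pi)) • v) = 𝓕 (bumpSchwartz hs hc) v := by
  rw [charFun_measureOfDensity_eq_fourier hs.continuous.measurable h0, SchwartzMap.fourier_coe]
  rfl

theorem charFun_bump_decay {g : E → ℝ} (hs : ContDiff ℝ ∞ g)
    (hc : HasCompactSupport g) (h0 : ∀ x, 0 ≤ g x) (k : ℕ) :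
    ∃ C, 0 < C ∧ ∀ t, ‖charFun (measureOfDensity g) t‖ * (1 + ‖t‖) ^ k ≤ C := by
  set f := 𝓕 (bumpSchwartz hs hc)
  set C₀ := 2 ^ k * ((Finset.Iic (k, 0)).sup fun m => SchwartzMap.seminorm ℂ m.1 m.2) f
  have hC₀ : 0 ≤ C₀ := by positivity
  refine ⟨(2 * Real.pi) ^ k * (C₀ + 1), by positivity, fun t => ?_⟩
  have h1 := SchwartzMap.one_add_le_sup_seminorm_apply (𝕜 := ℂ) (m := (k, 0)) (k := k) (n := 0)
    le_rfl le_rfl f ((-(2 * Real.pi))⁻¹ • t)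
  have h2 := charFun_eq_fourier_bumpSchwartz hs hc h0 ((-(2 * Real.pi))⁻¹ • t)
  have hpi : (-(2 * Real.pi)) ≠ 0 := by simp [Real.pi_ne_zero]
  rw [smul_smul, mul_inv_cancel₀ hpi, one_smul] at h2
  rw [norm_iteratedFDeriv_zero] at h1
  rw [h2]
  have hpi1 : 1 ≤ 2 * Real.pi := by linarith [Real.pi_gt_three]
  have h3 : 1 + ‖t‖ ≤ (2 * Real.pi) * (1 + ‖(-(2 * Real.pi))⁻¹ • t‖) := by
    rw [norm_smul, norm_inv, norm_neg, Real.norm_of_nonneg (by positivity), mul_add,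
      mul_inv_cancel_left₀ (by positivity)]
    linarith
  calc _ ≤ ‖f ((-(2 * Real.pi))⁻¹ • t)‖ *
        ((2 * Real.pi) * (1 + ‖(-(2 * Real.pi))⁻¹ • t‖)) ^ k := by gcongr
    _ = (2 * Real.pi) ^ k * ((1 + ‖(-(2 * Real.pi))⁻¹ • t‖) ^ k *
        ‖f ((-(2 * Real.pi))⁻¹ • t)‖) := by rw [mul_pow]; ring
    _ ≤ (2 * Real.pi) ^ k * (C₀ + 1) := by gcongr; exact h1.trans (by linarith)

theorem bump_eq_integral_charFun {g : E → ℝ} (hs : ContDiff ℝ ∞ g)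
    (hc : HasCompactSupport g) (h0 : ∀ x, 0 ≤ g x) (x : E) :
    (g x : ℂ) = ∫ v, Complex.exp ((2 * Real.pi * ⟪v, x⟫ : ℝ) * I) *
      charFun (measureOfDensity g) ((-(2 * Real.pi)) • v) := by
  have h : 𝓕⁻ (𝓕 (bumpSchwartz hs hc)) x = (g x : ℂ) := by
    rw [FourierTransform.fourierInv_fourier_eq]; rfl
  rw [← h, SchwartzMap.fourierInv_coe, Real.fourierInv_eq']
  simp_rw [charFun_eq_fourier_bumpSchwartz hs hc h0, smul_eq_mul]

theorem integrable_charFun_bump {g : E → ℝ} (hs : ContDiff ℝ ∞ g)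
    (hc : HasCompactSupport g) (h0 : ∀ x, 0 ≤ g x) :
    Integrable fun v => charFun (measureOfDensity g) ((-(2 * Real.pi)) • v) := by
  simp_rw [charFun_eq_fourier_bumpSchwartz hs hc h0]
  exact (𝓕 (bumpSchwartz hs hc)).integrable

/-- Equality in the triangle inequality would make the character constant almost everywhere on the
open set where `g` is nonzero, hence everywhere there by continuity. Its derivative at `z` in
direction `t` has modulus `‖t‖²`, which is not zero. -/
theorem norm_charFun_measureOfDensity_lt {g : E → ℝ} (hcont : Continuous g)
    (hg : Integrable g) (h0 : ∀ x, 0 ≤ g x) {z : E} (hz : g z ≠ 0) {t : E} (ht : t ≠ 0) :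
    ‖charFun (measureOfDensity g) t‖ < (measureOfDensity g).real Set.univ := by
  have := isFiniteMeasure_measureOfDensity hg
  rw [charFun_apply]
  rcases ae_eq_const_or_norm_integral_lt_of_norm_le_const (μ := measureOfDensity g)
    (f := fun x => Complex.exp (⟪x, t⟫ * I)) (C := 1)
    (ae_of_all _ fun x => (Complex.norm_exp_ofReal_mul_I _).le) with h | h
  · exfalso
    set a := ⨍ x, Complex.exp (⟪x, t⟫ * I) ∂(measureOfDensity g)
    rw [measureOfDensity, Filter.EventuallyEq, ae_withDensity_iff (by fun_prop)] at h
    have hopen : IsOpen {x : E | g x ≠ 0} := isOpen_ne_fun hcont continuous_const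
    have h1 : ∀ x, g x ≠ 0 → Complex.exp (⟪x, t⟫ * I) = a := by
      have h2 : Set.EqOn (fun x : E => Complex.exp (⟪x, t⟫ * I)) (fun _ => a) {x : E | g x ≠ 0} := by
        refine Measure.eqOn_open_of_ae_eq (μ := volume) ?_ hopen (by fun_prop) (by fun_prop)
        rw [Filter.EventuallyEq, ae_restrict_iff' hopen.measurableSet]
        filter_upwards [h] with x hx hgx
        exact hx (by simpa using lt_of_le_of_ne (h0 x) (Ne.symm hgx))
      exact fun x hx => h2 hx
    have hd : HasDerivAt (fun s : ℝ => Complex.exp (⟪z + s • t, t⟫ * I))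
        (Complex.exp (⟪z, t⟫ * I) * ((‖t‖ ^ 2 : ℝ) * I)) 0 := by
      have hd1 : HasDerivAt (fun s : ℝ => ((⟪z, t⟫ + s * ‖t‖ ^ 2 : ℝ) : ℂ) * I)
          ((‖t‖ ^ 2 : ℝ) * I) 0 := by
        have := ((hasDerivAt_id (0 : ℝ)).mul_const (‖t‖ ^ 2)).const_add ⟪z, t⟫
        simp only [one_mul, id] at this
        exact (this.ofReal_comp).mul_const I
      have := hd1.cexp
      simpa [inner_add_left, inner_smul_left, real_inner_self_eq_norm_sq] using this
    have hconst : (fun s : ℝ => Complex.exp (⟪z + s • t, t⟫ * I)) =ᶠ[𝓝 0] fun _ => a := by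
      have hct : Tendsto (fun s : ℝ => z + s • t) (𝓝 0) (𝓝 z) := by
        have : Continuous fun s : ℝ => z + s • t := by fun_prop
        simpa using this.tendsto 0
      filter_upwards [hct.eventually (hopen.mem_nhds hz)] with s hs
      exact h1 _ hs
    have := hd.unique ((hasDerivAt_const (0 : ℝ) a).congr_of_eventuallyEq hconst)
    simp [ht] at this
  · simpa using h

theorem measureOfDensity_real_univ_pos {g : E → ℝ} (hcont : Continuous g)
    (hg : Integrable g) (h0 : ∀ x, 0 ≤ g x) {z : E} (hz : g z ≠ 0) :
    0 < (measureOfDensity g).real Set.univ := by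
  have := isFiniteMeasure_measureOfDensity hg
  rw [measureReal_def, ENNReal.toReal_pos_iff]
  refine ⟨pos_iff_ne_zero.2 fun h => ?_, measure_lt_top _ _⟩
  rw [Measure.measure_univ_eq_zero] at h
  have h2 := (withDensity_eq_zero_iff (by fun_prop)).1 h
  have h3 : (fun x => ENNReal.ofReal (g x)) = 0 :=
    Continuous.ae_eq_iff_eq volume
      (ENNReal.continuous_ofReal.comp hcont) continuous_zero |>.1 h2
  have h4 := congrFun h3 z
  simp only [Pi.zero_apply, ENNReal.ofReal_eq_zero] at h4
  exact hz (le_antisymm h4 (h0 z))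

/-- Cramér's condition for `g`: decay handles large `t`, and compactness turns the strict pointwise
inequality into a uniform one on the remaining shell. -/
theorem exists_norm_charFun_bump_le {g : E → ℝ} (hs : ContDiff ℝ ∞ g)
    (hc : HasCompactSupport g) (h0 : ∀ x, 0 ≤ g x) {z : E} (hz : g z ≠ 0) {δ : ℝ} (hδ : 0 < δ) :
    ∃ κ, κ < (measureOfDensity g).real Set.univ ∧
      ∀ t, δ ≤ ‖t‖ → ‖charFun (measureOfDensity g) t‖ ≤ κ := by
  have hg := hs.continuous.integrable_of_hasCompactSupport hc (μ := volume)
  have := isFiniteMeasure_measureOfDensity hg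
  set G := measureOfDensity g
  have hGpos : 0 < G.real Set.univ := measureOfDensity_real_univ_pos hs.continuous hg h0 hz
  obtain ⟨C, hC, hdec⟩ := charFun_bump_decay hs hc h0 1
  -- Beyond this radius, the decay bound falls to half the total mass.
  set ρ := 2 * C / G.real Set.univ
  have hfar : ∀ t, ρ ≤ ‖t‖ → ‖charFun G t‖ ≤ G.real Set.univ / 2 := by
    intro t ht
    have h1 := hdec t
    rw [pow_one] at h1
    have h2 : 2 * C ≤ ‖t‖ * G.real Set.univ := by
      rwa [div_le_iff₀ hGpos] at ht
    have h3 : 0 < 1 + ‖t‖ := by positivity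
    rw [← mul_le_mul_iff_left₀ h3]
    linarith
  have hK : IsCompact {t : E | δ ≤ ‖t‖ ∧ ‖t‖ ≤ ρ} := by
    refine Metric.isCompact_of_isClosed_isBounded ?_ ?_
    · exact (isClosed_le continuous_const continuous_norm).inter
        (isClosed_le continuous_norm continuous_const)
    · refine (Metric.isBounded_closedBall (x := (0 : E)) (r := ρ)).subset ?_
      rintro t ⟨-, ht⟩
      simpa using ht
  rcases Set.eq_empty_or_nonempty {t : E | δ ≤ ‖t‖ ∧ ‖t‖ ≤ ρ} with he | hne
  · refine ⟨G.real Set.univ / 2, by linarith, fun t ht => hfar t ?_⟩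
    by_contra! hlt
    exact (Set.eq_empty_iff_forall_notMem.1 he t) ⟨ht, hlt.le⟩
  · obtain ⟨s, hsK, hmax⟩ := hK.exists_isMaxOn hne
      (f := fun t => ‖charFun G t‖) (by have := continuous_charFun (μ := G); fun_prop)
    refine ⟨max (G.real Set.univ / 2) ‖charFun G s‖, max_lt (by linarith) ?_, fun t ht => ?_⟩
    · refine norm_charFun_measureOfDensity_lt hs.continuous hg h0 hz ?_
      rintro rfl
      have := hsK.1
      rw [norm_zero] at this
      linarith
    · rcases le_total ρ ‖t‖ with h | h
      · exact (hfar t h).trans (le_max_left _ _)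
      · exact (hmax ⟨ht, h⟩).trans (le_max_right _ _)

/-- The density of the convolution of `B` with the measure of density `g`. -/
noncomputable def convDensity (B : Measure E) (g : E → ℝ) (x : E) : ℝ := ∫ y, g (x - y) ∂B

theorem convDensity_nonneg {B : Measure E} {g : E → ℝ} (h0 : ∀ x, 0 ≤ g x) (x : E) :
    0 ≤ convDensity B g x := integral_nonneg fun _ => h0 _

theorem measurable_convDensity {B : Measure E} [SFinite B] {g : E → ℝ} (hg : Measurable g) :
    Measurable (convDensity B g) := by
  have h : StronglyMeasurable (Function.uncurry fun x y : E => g (x - y)) :=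
    (hg.comp (measurable_fst.sub measurable_snd)).stronglyMeasurable
  exact (h.integral_prod_right (ν := B)).measurable

theorem conv_measureOfDensity {B : Measure E} [IsFiniteMeasure B] {g : E → ℝ}
    (hs : ContDiff ℝ ∞ g) (hc : HasCompactSupport g) (h0 : ∀ x, 0 ≤ g x) :
    B ∗ measureOfDensity g = measureOfDensity (convDensity B g) := by
  have hg := hs.continuous.integrable_of_hasCompactSupport hc (μ := volume)
  have := isFiniteMeasure_measureOfDensity hg
  have hgm := hs.continuous.measurable
  obtain ⟨M, hM⟩ := hs.continuous.bounded_above_of_compact_support hc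
  ext S hS
  rw [← lintegral_indicator_one hS, Measure.lintegral_conv (measurable_one.indicator hS)]
  have h1 : ∀ x, ∫⁻ y, S.indicator 1 (x + y) ∂(measureOfDensity g) =
      ∫⁻ z in S, ENNReal.ofReal (g (z - x)) := by
    intro x
    have hmx : Measurable fun y => S.indicator (1 : E → ℝ≥0∞) (x + y) :=
      (measurable_one.indicator hS).comp (measurable_const_add x)
    rw [measureOfDensity, lintegral_withDensity_eq_lintegral_mul _ (by fun_prop) hmx,
      ← lintegral_sub_right_eq_self _ x, ← lintegral_indicator hS]
    refine lintegral_congr fun z => ?_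
    by_cases hz : z ∈ S <;> simp [hz]
  simp_rw [h1]
  rw [lintegral_lintegral_swap (by fun_prop), measureOfDensity, withDensity_apply _ hS]
  refine lintegral_congr fun z => ?_
  rw [convDensity, ofReal_integral_eq_lintegral_ofReal _ (ae_of_all _ fun _ => h0 _)]
  refine Integrable.of_bound (by fun_prop) M (ae_of_all _ fun y => hM _)

/-- Inversion for `g` integrated against `B`. Fubini applies because `B` is finite and the transform
of `g` is integrable. -/
theorem convDensity_eq_integral_charFun {B : Measure E} [IsFiniteMeasure B] {g : E → ℝ}
    (hs : ContDiff ℝ ∞ g) (hc : HasCompactSupport g) (h0 : ∀ x, 0 ≤ g x) (x : E) :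
    (convDensity B g x : ℂ) = ∫ v, Complex.exp ((2 * Real.pi * ⟪v, x⟫ : ℝ) * I) *
      charFun (B ∗ measureOfDensity g) ((-(2 * Real.pi)) • v) := by
  have hg := hs.continuous.integrable_of_hasCompactSupport hc (μ := volume)
  have := isFiniteMeasure_measureOfDensity hg
  have hint := integrable_charFun_bump hs hc h0
  rw [convDensity, ← integral_complex_ofReal]
  simp_rw [bump_eq_integral_charFun hs hc h0]
  rw [integral_integral_swap]
  · refine integral_congr_ae (ae_of_all _ fun v => ?_)
    simp only
    rw [charFun_conv, charFun_apply (μ := B), ← mul_assoc, ← integral_const_mul, ← integral_mul_const]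
    refine integral_congr_ae (ae_of_all _ fun y => ?_)
    simp only
    rw [← Complex.exp_add]
    congr 2
    simp only [inner_sub_right, inner_smul_right, real_inner_comm v y]
    push_cast
    ring
  · have h1 : Integrable (fun p : E × E =>
        charFun (measureOfDensity g) ((-(2 * Real.pi)) • p.2)) (B.prod volume) :=
      hint.comp_snd B
    refine h1.bdd_mul (c := 1) (by fun_prop) (ae_of_all _ fun p => ?_)
    exact (Complex.norm_exp_ofReal_mul_I _).le

end BumpFourier

/-! ### Second-order expansion at the origin and its central limit consequences. -/

section CharFunExpansion

set_option linter.unusedSectionVars false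

open scoped ENNReal RealInnerProductSpace
open Complex (I)

theorem norm_exp_mul_I_sub_le_cube {u : ℝ} (hu : |u| ≤ 1) :
    ‖Complex.exp (u * I) - (1 + u * I - u ^ 2 / 2)‖ ≤ |u| ^ 3 := by
  have h := Complex.exp_bound (x := u * I) (by simpa using hu) (n := 3) (by norm_num)
  have hs : ∑ m ∈ Finset.range 3, ((u : ℂ) * I) ^ m / (m.factorial : ℂ) = 1 + u * I - u ^ 2 / 2 := by
    simp [Finset.sum_range_succ, mul_pow, Nat.factorial]
    ring
  rw [hs] at h
  refine h.trans ?_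
  rw [norm_mul, Complex.norm_I, mul_one, Complex.norm_real, Real.norm_eq_abs]
  norm_num [Nat.factorial]
  nlinarith [pow_nonneg (abs_nonneg u) 3]

theorem norm_exp_mul_I_sub_le_sq (u : ℝ) :
    ‖Complex.exp (u * I) - (1 + u * I - u ^ 2 / 2)‖ ≤ 4 * u ^ 2 := by
  rcases le_total |u| 1 with hu | hu
  · refine (norm_exp_mul_I_sub_le_cube hu).trans ?_
    rw [← sq_abs u]
    nlinarith [sq_nonneg |u|, abs_nonneg u]
  · have h1 : ‖Complex.exp (u * I) - (1 + u * I - u ^ 2 / 2)‖ ≤ 1 + (1 + |u| + u ^ 2 / 2) := by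
      refine (norm_sub_le _ _).trans ?_
      rw [Complex.norm_exp_ofReal_mul_I]
      gcongr
      refine (norm_sub_le _ _).trans ?_
      gcongr
      · refine (norm_add_le _ _).trans ?_
        simp
      · simp
    refine h1.trans ?_
    rw [← sq_abs u]
    nlinarith

variable {E : Type*} [NormedAddCommGroup E] [InnerProductSpace ℝ E] [FiniteDimensional ℝ E]
  [MeasurableSpace E] [BorelSpace E]

/-- Dominated convergence with only second moments: the cubic Taylor bound gives the pointwise
limit, the global quadratic bound gives the integrable majorant `4‖x‖²`. -/
theorem charFun_sub_isLittleO {μ : Measure E} [IsProbabilityMeasure μ] (hL2 : MemLp id 2 μ)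
    (hmean : ∀ t, ∫ x, ⟪x, t⟫ ∂μ = 0) (hvar : ∀ t, ∫ x, ⟪x, t⟫ ^ 2 ∂μ = ‖t‖ ^ 2) :
    (fun t => charFun μ t - (1 - (‖t‖ : ℂ) ^ 2 / 2)) =o[𝓝 0] fun t : E => ‖t‖ ^ 2 := by
  have hi1 : Integrable (fun x : E => ‖x‖ ^ 2) μ := by
    simpa using hL2.integrable_norm_pow (p := 2) (by norm_num)
  have hin (t : E) : MemLp (fun x : E => ⟪x, t⟫) 2 μ := hL2.inner_const t
  have hi2 (t : E) : Integrable (fun x : E => ⟪x, t⟫) μ := (hin t).integrable (by norm_num)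
  have hi3 (t : E) : Integrable (fun x : E => ⟪x, t⟫ ^ 2) μ := (hin t).integrable_sq
  set r : E → E → ℂ := fun t x => Complex.exp (⟪x, t⟫ * I) - (1 + ⟪x, t⟫ * I - (⟪x, t⟫ : ℂ) ^ 2 / 2)
    with hr
  have heq : ∀ t, charFun μ t - (1 - (‖t‖ : ℂ) ^ 2 / 2) = ∫ x, r t x ∂μ := by
    intro t
    have e1 : Integrable (fun x : E => Complex.exp (⟪x, t⟫ * I)) μ :=
      Integrable.of_bound (by fun_prop) 1 (ae_of_all _ fun x => (Complex.norm_exp_ofReal_mul_I _).le)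
    have e2 : Integrable (fun x : E => (⟪x, t⟫ : ℂ) * I) μ := (hi2 t).ofReal.mul_const I
    have e3 : Integrable (fun x : E => (⟪x, t⟫ : ℂ) ^ 2 / 2) μ := by
      simpa using ((hi3 t).ofReal (𝕜 := ℂ)).div_const 2
    have m2 : ∫ x, (⟪x, t⟫ : ℂ) * I ∂μ = 0 := by
      rw [integral_mul_const, integral_complex_ofReal, hmean]; simp
    have m3 : ∫ x, (⟪x, t⟫ : ℂ) ^ 2 / 2 ∂μ = (‖t‖ : ℂ) ^ 2 / 2 := by
      rw [integral_div]
      congr 1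
      have := integral_complex_ofReal (μ := μ) (f := fun x : E => ⟪x, t⟫ ^ 2)
      rw [hvar] at this
      simpa using this
    simp only [hr]
    rw [integral_sub e1 (by fun_prop), integral_sub (by fun_prop) e3,
      integral_add (by fun_prop) e2, m2, m3]
    simp [charFun_apply]
  have hbig : (fun t => charFun μ t - (1 - (‖t‖ : ℂ) ^ 2 / 2)) =O[𝓝 0] fun t => ∫ x, ‖r t x‖ ∂μ := by
    refine Asymptotics.IsBigO.of_bound 1 (Eventually.of_forall fun t => ?_)
    rw [heq, one_mul]
    exact (norm_integral_le_integral_norm _).trans (le_abs_self _)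
  refine hbig.trans_isLittleO ?_
  rw [Asymptotics.isLittleO_iff_tendsto]
  swap
  · intro t ht
    have ht0 : t = 0 := by simpa using ht
    simp [hr, ht0]
  simp_rw [← integral_div]
  rw [← integral_zero E ℝ (μ := μ)]
  refine tendsto_integral_filter_of_dominated_convergence (fun x => 4 * ‖x‖ ^ 2)
    (Eventually.of_forall fun t => ?_) (Eventually.of_forall fun t => ae_of_all _ fun x => ?_)
    (hi1.const_mul 4) (ae_of_all _ fun x => ?_)
  · have : Continuous fun x => ‖r t x‖ / ‖t‖ ^ 2 := by simp only [hr]; fun_prop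
    exact this.aestronglyMeasurable
  · rw [Real.norm_of_nonneg (by positivity)]
    refine div_le_of_le_mul₀ (by positivity) (by positivity) ?_
    refine (norm_exp_mul_I_sub_le_sq _).trans ?_
    rw [mul_assoc, ← mul_pow, ← sq_abs ⟪x, t⟫]
    gcongr
    exact abs_real_inner_le_norm x t
  · have hlim : Tendsto (fun t : E => ‖x‖ ^ 3 * ‖t‖) (𝓝 0) (𝓝 0) := by
      have : Continuous fun t : E => ‖x‖ ^ 3 * ‖t‖ := by fun_prop
      simpa using this.tendsto 0
    have hsmall : ∀ᶠ t : E in 𝓝 0, |⟪x, t⟫| ≤ 1 := by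
      have hcont : Continuous fun t : E => |⟪x, t⟫| := by fun_prop
      have := hcont.tendsto 0
      rw [inner_zero_right, abs_zero] at this
      exact (this.eventually_lt_const one_pos).mono fun _ h => h.le
    refine squeeze_zero' (Eventually.of_forall fun t => by positivity) ?_ hlim
    filter_upwards [hsmall] with t ht
    refine div_le_of_le_mul₀ (by positivity) (by positivity) ?_
    refine (norm_exp_mul_I_sub_le_cube ht).trans ?_
    calc |⟪x, t⟫| ^ 3 ≤ (‖x‖ * ‖t‖) ^ 3 := by
          gcongr
          exact abs_real_inner_le_norm x t
      _ = ‖x‖ ^ 3 * ‖t‖ * ‖t‖ ^ 2 := by ring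

theorem exists_norm_charFun_le_exp {μ : Measure E}
    (h : (fun t => charFun μ t - (1 - (‖t‖ : ℂ) ^ 2 / 2)) =o[𝓝 0] fun t : E => ‖t‖ ^ 2) :
    ∃ δ > 0, ∀ t : E, ‖t‖ ≤ δ → ‖charFun μ t‖ ≤ Real.exp (-(‖t‖ ^ 2 / 4)) := by
  -- An error of at most `‖t‖²/4` leaves `1 - ‖t‖²/4`, which is below the exponential. The cap `‖t‖
  -- ≤ 1` makes `1 - ‖t‖²/2` its own norm.
  obtain ⟨ε, hε, hb⟩ := Metric.eventually_nhds_iff.1 (h.bound (c := 1 / 4) (by norm_num))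
  refine ⟨min (ε / 2) 1, by positivity, fun t ht => ?_⟩
  have ht1 : ‖t‖ ≤ 1 := ht.trans (min_le_right _ _)
  have ht2 : dist t 0 < ε := by
    rw [dist_zero_right]
    linarith [ht.trans (min_le_left _ _)]
  have h1 := hb ht2
  rw [Real.norm_of_nonneg (by positivity)] at h1
  have h2 : ‖(1 - (‖t‖ : ℂ) ^ 2 / 2)‖ = 1 - ‖t‖ ^ 2 / 2 := by
    have : (1 - (‖t‖ : ℂ) ^ 2 / 2) = ((1 - ‖t‖ ^ 2 / 2 : ℝ) : ℂ) := by push_cast; rfl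
    rw [this, Complex.norm_real, Real.norm_of_nonneg]
    nlinarith [norm_nonneg t]
  have h3 := norm_sub_norm_le (charFun μ t) (1 - (‖t‖ : ℂ) ^ 2 / 2)
  have h4 := Real.add_one_le_exp (-(‖t‖ ^ 2 / 4))
  linarith

theorem tendsto_charFun_pow {μ : Measure E}
    (h : (fun t => charFun μ t - (1 - (‖t‖ : ℂ) ^ 2 / 2)) =o[𝓝 0] fun t : E => ‖t‖ ^ 2) (t : E) :
    Tendsto (fun n : ℕ => charFun μ ((√(n : ℝ))⁻¹ • t) ^ n) atTop
      (𝓝 (Complex.exp (-((‖t‖ : ℂ) ^ 2 / 2)))) := by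
  apply Complex.tendsto_pow_exp_of_isLittleO_sub_add_div
  have hlim : Tendsto (fun n : ℕ => (√(n : ℝ))⁻¹ • t) atTop (𝓝 0) := by
    rw [← zero_smul ℝ t]
    exact (tendsto_inv_atTop_zero.comp <| Real.tendsto_sqrt_atTop.comp <|
      tendsto_natCast_atTop_atTop).smul_const t
  have hc := h.comp_tendsto hlim
  have hsq (n : ℕ) : ‖(√(n : ℝ))⁻¹ • t‖ ^ 2 = ‖t‖ ^ 2 / n := by
    rw [norm_smul, mul_pow, norm_inv, Real.norm_of_nonneg (Real.sqrt_nonneg _), inv_pow,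
      Real.sq_sqrt (Nat.cast_nonneg n)]
    ring
  refine Asymptotics.IsLittleO.of_const_mul_right (c := (‖t‖ : ℂ) ^ 2) ?_
  rw [← Asymptotics.isLittleO_norm_right]
  rw [← Asymptotics.isLittleO_norm_right] at hc
  refine (hc.congr (fun n => ?_) fun n => ?_)
  · simp only [Function.comp]
    have := congrArg (fun x : ℝ => (x : ℂ)) (hsq n)
    push_cast at this
    rw [this]
    ring
  · simp only [Function.comp, hsq]
    simp [div_eq_mul_inv]

end CharFunExpansion

/-! ### Splitting off an exponentially small remainder; L¹ convergence of characteristic functions.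
-/

section Truncation

open scoped ENNReal ContDiff RealInnerProductSpace FourierTransform
open Complex (I)

variable {E : Type*} [NormedAddCommGroup E] [InnerProductSpace ℝ E] [FiniteDimensional ℝ E]
  [MeasurableSpace E] [BorelSpace E]

theorem charFun_add_measure (μ ν : Measure E) [IsFiniteMeasure μ] [IsFiniteMeasure ν] (t : E) :
    charFun (μ + ν) t = charFun μ t + charFun ν t := by
  simp only [charFun_apply]
  rw [integral_add_measure] <;>
  exact Integrable.of_bound (by fun_prop) 1
    (ae_of_all _ fun x => (Complex.norm_exp_ofReal_mul_I _).le)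

/-- Telescoping gives `B = ∑ (G + W)^(m-1-j) ∗ W^j` over `j < m`, with convolution powers. These are
`m` terms of size at most `θ^(m-1)`; multiplying by `θ` keeps the bound meaningful at `m = 0`. -/
theorem exists_conv_decomposition (G W : Measure E) [IsFiniteMeasure G] [IsFiniteMeasure W]
    (m : ℕ) :
    ∃ B V : Measure E, IsFiniteMeasure B ∧ IsFiniteMeasure V ∧
      (∀ t, charFun V t = charFun W t ^ m) ∧
      (∀ t, charFun (G + W) t ^ m = charFun B t * charFun G t + charFun V t) ∧
      (∀ t θ, ‖charFun (G + W) t‖ ≤ θ → ‖charFun W t‖ ≤ θ →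
        ‖charFun B t‖ * θ ≤ m * θ ^ m) := by
  induction m with
  | zero =>
    refine ⟨0, Measure.dirac 0, inferInstance, inferInstance, ?_, ?_, ?_⟩ <;> simp
  | succ m ih =>
    obtain ⟨B, V, hB, hV, h1, h2, h3⟩ := ih
    refine ⟨B ∗ (G + W) + V, V ∗ W, inferInstance, inferInstance, fun t => ?_, fun t => ?_,
      fun t θ hν hW => ?_⟩
    · rw [charFun_conv, h1, pow_succ]
    · rw [pow_succ, h2, charFun_add_measure, charFun_add_measure (B ∗ (G + W)), charFun_conv, charFun_conv, h1,
        charFun_add_measure]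
      ring
    · have hθ : 0 ≤ θ := (norm_nonneg _).trans hν
      have h4 := h3 t θ hν hW
      calc ‖charFun (B ∗ (G + W) + V) t‖ * θ
          ≤ (‖charFun B t‖ * θ + θ ^ m) * θ := by
            rw [charFun_add_measure, charFun_conv, h1]
            gcongr
            refine (norm_add_le _ _).trans ?_
            rw [norm_mul, norm_pow]
            gcongr
        _ ≤ (m * θ ^ m + θ ^ m) * θ := by gcongr
        _ = (m + 1 : ℕ) * θ ^ (m + 1) := by push_cast; ring

/-- The floor loses less than one unit in the exponent, and the factor `θ⁻¹` pays for it. -/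
theorem pow_div_le_mul_exp {θ : ℝ} (h0 : 0 < θ) (h1 : θ < 1) {N : ℕ} (hN : 0 < N) (n : ℕ) :
    θ ^ (n / N) ≤ θ⁻¹ * Real.exp (-(-Real.log θ / N * n)) := by
  have hlog : Real.log θ < 0 := Real.log_neg h0 h1
  have hN' : (0 : ℝ) < N := by exact_mod_cast hN
  have hlt : (n : ℝ) / N ≤ (n / N : ℕ) + 1 := by
    rw [div_le_iff₀ hN']
    have := (Nat.lt_mul_div_succ n hN).le
    have h2 : (n : ℝ) ≤ N * ((n / N : ℕ) + 1) := by exact_mod_cast this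
    linarith
  have h2 : θ ^ (n / N) = Real.exp (Real.log θ * (n / N : ℕ)) := by
    rw [mul_comm, Real.exp_nat_mul, Real.exp_log h0]
  have h3 : θ⁻¹ = Real.exp (-Real.log θ) := by rw [Real.exp_neg, Real.exp_log h0]
  rw [h2, h3, ← Real.exp_add]
  refine Real.exp_le_exp.2 ?_
  have h4 : -(-Real.log θ / N * n) = Real.log θ * (n / N) := by ring
  rw [h4]
  nlinarith

theorem integrable_exp_neg_mul_sq_norm {b : ℝ} (hb : 0 < b) :
    Integrable fun t : E => Real.exp (-(b * ‖t‖ ^ 2)) := by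
  have h := (GaussianFourier.integrable_cexp_neg_mul_sq_norm_add (V := E) (b := (b : ℂ))
    (by simpa using hb) 0 0).norm
  refine h.congr (ae_of_all _ fun t => ?_)
  simp only [Complex.norm_exp]
  congr 1
  have : (-(b : ℂ) * (‖t‖ : ℂ) ^ 2 + 0 * (⟪(0 : E), t⟫ : ℂ)) = ((-(b * ‖t‖ ^ 2) : ℝ) : ℂ) := by
    push_cast; ring
  rw [this, Complex.ofReal_re]

/-- Dominated convergence after rescaling. For `‖t‖ ≤ δ√n` the Gaussian bound on `f` controls the
power; for larger `t` an integrable power of `1 + ‖t‖` dominates, as `a n` absorbs the rescaling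
factor. -/
theorem tendsto_integral_norm_sub_gaussian {f : E → ℂ} {F r : ℕ → E → ℂ} {a : ℕ → ℝ}
    {δ D ρ K : ℝ} (hδ : 0 < δ) (hρ : 0 < ρ)
    (hF : ∀ n t, F n t = f t ^ n - r n t) (hcont : ∀ n, Continuous (F n))
    (hlim : ∀ t, Tendsto (fun n : ℕ => f ((√(n : ℝ))⁻¹ • t) ^ n) atTop
      (𝓝 (Complex.exp (-((‖t‖ : ℂ) ^ 2 / 2)))))
    (hnear : ∀ t, ‖t‖ ≤ δ → ‖f t‖ ≤ Real.exp (-(‖t‖ ^ 2 / 4)))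
    (hr : ∀ n t, ‖r n t‖ ≤ D * Real.exp (-(ρ * n)))
    (hfar : ∀ n t, δ ≤ ‖t‖ → ‖F n t‖ * (1 + ‖t‖) ^ (Module.finrank ℝ E + 1) ≤ a n)
    (ha : ∀ n, a n * √(n : ℝ) ^ (Module.finrank ℝ E + 1) ≤ K) :
    Tendsto (fun n : ℕ => ∫ t : E, ‖F n ((√(n : ℝ))⁻¹ • t) -
      Complex.exp (-((‖t‖ : ℂ) ^ 2 / 2))‖) atTop (𝓝 0) := by
  set k := Module.finrank ℝ E + 1
  have hD : 0 ≤ D := by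
    have := (norm_nonneg _).trans (hr 0 0)
    simpa using this
  have hgn (t : E) : ‖Complex.exp (-((‖t‖ : ℂ) ^ 2 / 2))‖ = Real.exp (-(1 / 2 * ‖t‖ ^ 2)) := by
    rw [Complex.norm_exp]
    congr 1
    have : (-((‖t‖ : ℂ) ^ 2 / 2)) = ((-(1 / 2 * ‖t‖ ^ 2) : ℝ) : ℂ) := by push_cast; ring
    rw [this, Complex.ofReal_re]
  have hint : Integrable fun t : E => (1 + ‖t‖) ^ (-(k : ℝ)) :=
    integrable_one_add_norm (by simp [k])
  have hexp0 : Tendsto (fun n : ℕ => D * Real.exp (-(ρ * n))) atTop (𝓝 0) := by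
    have : Tendsto (fun n : ℕ => Real.exp (-(ρ * n))) atTop (𝓝 0) :=
      Real.tendsto_exp_neg_atTop_nhds_zero.comp
        (tendsto_natCast_atTop_atTop.const_mul_atTop hρ)
    simpa using this.const_mul D
  rw [← integral_zero E ℝ (μ := volume)]
  refine tendsto_integral_filter_of_dominated_convergence
    (fun t => Real.exp (-(1 / 4 * ‖t‖ ^ 2)) + D * Real.exp (-(ρ / δ ^ 2 * ‖t‖ ^ 2)) +
      |K| * (1 + ‖t‖) ^ (-(k : ℝ)) + Real.exp (-(1 / 2 * ‖t‖ ^ 2)))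
    (Eventually.of_forall fun n => ?_) ?_ ?_ (ae_of_all _ fun t => ?_)
  · have h1 : Continuous fun t => F n ((√(n : ℝ))⁻¹ • t) := (hcont n).comp (by fun_prop)
    have : Continuous fun t : E => ‖F n ((√(n : ℝ))⁻¹ • t) -
      Complex.exp (-((‖t‖ : ℂ) ^ 2 / 2))‖ := by fun_prop
    exact this.aestronglyMeasurable
  · filter_upwards [eventually_ge_atTop 1] with n hn
    refine ae_of_all _ fun t => ?_
    rw [norm_norm]
    refine (norm_sub_le _ _).trans ?_
    rw [hgn]
    gcongr
    have hn1 : (1 : ℝ) ≤ n := by exact_mod_cast hn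
    have hs1 : 1 ≤ √(n : ℝ) := Real.one_le_sqrt.2 hn1
    have hs0 : 0 < √(n : ℝ) := by linarith
    set s := (√(n : ℝ))⁻¹ • t with hs
    have hst : ‖t‖ = √(n : ℝ) * ‖s‖ := by
      rw [hs, norm_smul, norm_inv, Real.norm_of_nonneg hs0.le, mul_inv_cancel_left₀ hs0.ne']
    have hst2 : ‖t‖ ^ 2 = n * ‖s‖ ^ 2 := by
      rw [hst, mul_pow, Real.sq_sqrt (by linarith)]
    rcases le_total ‖s‖ δ with h | h
    · have h1 : ‖F n s‖ ≤ Real.exp (-(1 / 4 * ‖t‖ ^ 2)) +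
          D * Real.exp (-(ρ / δ ^ 2 * ‖t‖ ^ 2)) := by
        rw [hF]
        refine (norm_sub_le _ _).trans (add_le_add ?_ ((hr n s).trans ?_))
        · rw [norm_pow]
          refine (pow_le_pow_left₀ (norm_nonneg _) (hnear s h) n).trans ?_
          rw [← Real.exp_nat_mul, hst2]
          refine Real.exp_le_exp.2 (le_of_eq (by ring))
        -- The remainder bound does not depend on `t`, but in this zone `n ≥ ‖t‖²/δ²`, which
        -- converts it into an integrable Gaussian.
        · refine mul_le_mul_of_nonneg_left (Real.exp_le_exp.2 (neg_le_neg ?_)) hD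
          rw [hst2, div_mul_eq_mul_div, div_le_iff₀ (by positivity)]
          have h3 : ‖s‖ ^ 2 ≤ δ ^ 2 := by gcongr
          rw [mul_assoc]
          exact mul_le_mul_of_nonneg_left
            (mul_le_mul_of_nonneg_left h3 (by linarith)) hρ.le
      have h2 : 0 ≤ |K| * (1 + ‖t‖) ^ (-(k : ℝ)) := by positivity
      linarith
    · have h1 : ‖F n s‖ ≤ |K| * (1 + ‖t‖) ^ (-(k : ℝ)) := by
        rw [Real.rpow_neg (by positivity), Real.rpow_natCast, ← div_eq_mul_inv,
          le_div_iff₀ (by positivity)]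
        calc ‖F n s‖ * (1 + ‖t‖) ^ k ≤ ‖F n s‖ * (√(n : ℝ) * (1 + ‖s‖)) ^ k := by
              gcongr
              rw [hst, mul_add]
              linarith
          _ = (‖F n s‖ * (1 + ‖s‖) ^ k) * √(n : ℝ) ^ k := by rw [mul_pow]; ring
          _ ≤ a n * √(n : ℝ) ^ k := by gcongr; exact hfar n s h
          _ ≤ |K| := (ha n).trans (le_abs_self K)
      have h2 : 0 ≤ Real.exp (-(1 / 4 * ‖t‖ ^ 2)) + D * Real.exp (-(ρ / δ ^ 2 * ‖t‖ ^ 2)) := by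
        positivity
      linarith
  · exact (((integrable_exp_neg_mul_sq_norm (by norm_num)).add
      ((integrable_exp_neg_mul_sq_norm (by positivity)).const_mul D)).add
      (hint.const_mul |K|)).add (integrable_exp_neg_mul_sq_norm (by norm_num))
  · have h1 : Tendsto (fun n : ℕ => r n ((√(n : ℝ))⁻¹ • t)) atTop (𝓝 0) :=
      squeeze_zero_norm (fun n => hr n _) hexp0
    have h2 := (((hlim t).sub h1).sub_const (Complex.exp (-((‖t‖ : ℂ) ^ 2 / 2)))).norm
    simpa [hF] using h2

theorem exists_bound_mul_exp {ρ : ℝ} (hρ : 0 < ρ) (k : ℕ) :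
    ∃ K, ∀ n : ℕ, (n : ℝ) ^ k * Real.exp (-(ρ * n)) ≤ K := by
  have h := tendsto_pow_const_mul_const_pow_of_abs_lt_one k (r := Real.exp (-ρ))
    (by rw [abs_of_pos (Real.exp_pos _)]; exact Real.exp_lt_one_iff.2 (by linarith))
  obtain ⟨K, hK⟩ := h.bddAbove_range
  refine ⟨K, fun n => ?_⟩
  have := hK (Set.mem_range_self n)
  rw [← Real.exp_nat_mul] at this
  rwa [mul_neg, mul_comm (n : ℝ) ρ] at this

theorem exists_truncation {L : ℕ → Measure E} [∀ n, IsProbabilityMeasure (L n)]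
    (hL : ∀ n t, charFun (L n) t = charFun (L 1) t ^ n)
    (hexp : (fun t => charFun (L 1) t - (1 - (‖t‖ : ℂ) ^ 2 / 2)) =o[𝓝 0] fun t : E => ‖t‖ ^ 2)
    {N : ℕ} (hN : 0 < N) {g : E → ℝ} (hs : ContDiff ℝ ∞ g) (hc : HasCompactSupport g)
    (h0 : ∀ x, 0 ≤ g x) {z : E} (hz : g z ≠ 0) (hle : measureOfDensity g ≤ L N) :
    ∃ B R : ℕ → Measure E, (∀ n, IsFiniteMeasure (B n)) ∧
      (∀ n, L n = B n ∗ measureOfDensity g + R n) ∧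
      (∃ D ρ : ℝ, 0 < D ∧ 0 < ρ ∧
        ∀ n : ℕ, R n Set.univ ≤ ENNReal.ofReal (D * Real.exp (-(ρ * n)))) ∧
      Tendsto (fun n : ℕ => ∫ t : E, ‖charFun (B n ∗ measureOfDensity g) ((√(n : ℝ))⁻¹ • t) -
        Complex.exp (-((‖t‖ : ℂ) ^ 2 / 2))‖) atTop (𝓝 0) := by
  have hg := hs.continuous.integrable_of_hasCompactSupport hc (μ := volume)
  have hGfin := isFiniteMeasure_measureOfDensity hg
  set G := measureOfDensity g
  set W := L N - G
  have hW : G + W = L N := by rw [add_comm]; exact Measure.sub_add_cancel_of_le hle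
  have hWfin : IsFiniteMeasure W := inferInstance
  obtain ⟨δ, hδ, hnear⟩ := exists_norm_charFun_le_exp hexp
  obtain ⟨κ, hκ, hfarG⟩ := exists_norm_charFun_bump_le hs hc h0 hz hδ
  have hmass : G.real Set.univ + W.real Set.univ = 1 := by
    rw [← measureReal_add_apply, hW]; simp
  have hW0 : 0 ≤ W.real Set.univ := measureReal_nonneg
  set w := W.real Set.univ with hw
  -- `θ` bounds the mass of `W` and, for `‖t‖ ≥ δ`, the characteristic function of `L N` through `κ
  -- + w`; the `1 / 2` only ensures positivity.
  obtain ⟨θ, hθ1, hθ2⟩ : ∃ θ, max (max (κ + w) w) (1 / 2) < θ ∧ θ < 1 :=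
    exists_between (max_lt (max_lt (by linarith) (by
      have : 0 < G.real Set.univ := measureOfDensity_real_univ_pos hs.continuous hg h0 hz
      linarith)) (by norm_num))
  have hθ0 : 0 < θ := by linarith [le_max_right (max (κ + w) w) (1 / 2 : ℝ)]
  have hθw : w ≤ θ := ((le_max_right _ _).trans (le_max_left _ _)).trans hθ1.le
  have hθκ : κ + w ≤ θ := ((le_max_left _ _).trans (le_max_left _ _)).trans hθ1.le
  set ρ := -Real.log θ / N
  have hN' : (0 : ℝ) < N := by exact_mod_cast hN
  have hρ : 0 < ρ := div_pos (by linarith [Real.log_neg hθ0 hθ2]) hN'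
  choose B V hB hV hV1 hV2 hV3 using exists_conv_decomposition G W
  rw [hW] at hV2 hV3
  have hWle (t : E) : ‖charFun W t‖ ≤ θ := (norm_charFun_le t).trans hθw
  have hRle (n : ℕ) (t : E) : ‖charFun (V (n / N) ∗ L (n % N)) t‖ ≤
      θ⁻¹ * Real.exp (-(ρ * n)) := by
    rw [charFun_conv, norm_mul, hV1, norm_pow]
    calc _ ≤ θ ^ (n / N) * 1 := by
          gcongr
          · exact hWle t
          · exact norm_charFun_le_one t
      _ ≤ _ := by rw [mul_one]; exact pow_div_le_mul_exp hθ0 hθ2 hN n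
  have hfac (n : ℕ) (t : E) : charFun (L 1) t ^ n =
      charFun ((B (n / N) ∗ L (n % N)) ∗ G) t + charFun (V (n / N) ∗ L (n % N)) t := by
    have h1 : charFun (L 1) t ^ n = charFun (L N) t ^ (n / N) * charFun (L (n % N)) t := by
      rw [hL N, hL (n % N), ← pow_mul, ← pow_add, Nat.div_add_mod]
    rw [h1, hV2, charFun_conv, charFun_conv, charFun_conv]
    ring
  -- Only complete blocks of `N` summands are decomposed; the leftover `n % N` summands enter as a
  -- probability factor, harmless in every bound.
  refine ⟨fun n => B (n / N) ∗ L (n % N), fun n => V (n / N) ∗ L (n % N),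
    fun n => inferInstance, fun n => ?_, ⟨θ⁻¹, ρ, by positivity, hρ, fun n => ?_⟩, ?_⟩
  · refine Measure.ext_of_charFun (funext fun t => ?_)
    rw [hL, charFun_add_measure, hfac]
  -- The value of a characteristic function at 0 is the total mass.
  · have h1 := hRle n 0
    rw [charFun_zero, Complex.norm_real, Real.norm_of_nonneg measureReal_nonneg] at h1
    exact (ENNReal.le_ofReal_iff_toReal_le (measure_ne_top _ _) (by positivity)).2 h1
  · obtain ⟨C, hC, hdec⟩ := charFun_bump_decay hs hc h0 (Module.finrank ℝ E + 1)
    -- The exponent is dimension plus 2: one power of `n` for the number of terms in `B`, the others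
    -- for the rescaling, using `√n ≤ n`.
    obtain ⟨K, hK⟩ := exists_bound_mul_exp hρ (Module.finrank ℝ E + 2)
    refine tendsto_integral_norm_sub_gaussian (f := charFun (L 1))
      (r := fun n => charFun (V (n / N) ∗ L (n % N)))
      (a := fun n => θ⁻¹ * ((n / N : ℕ) * θ ^ (n / N)) * C) (K := θ⁻¹ * θ⁻¹ * C * K)
      hδ hρ (fun n t => ?_) (fun n => continuous_charFun)
      (tendsto_charFun_pow hexp) hnear hRle (fun n t ht => ?_) (fun n => ?_)
    · rw [hfac]; ring
    · have hν : ‖charFun (L N) t‖ ≤ θ := by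
        rw [← hW, charFun_add_measure]
        exact (norm_add_le _ _).trans
          ((add_le_add (hfarG t ht) (norm_charFun_le t)).trans hθκ)
      have hB' : ‖charFun (B (n / N)) t‖ ≤ θ⁻¹ * ((n / N : ℕ) * θ ^ (n / N)) := by
        rw [inv_mul_eq_div, le_div_iff₀ hθ0]
        exact hV3 (n / N) t θ hν (hWle t)
      rw [charFun_conv, charFun_conv, norm_mul, norm_mul, mul_assoc]
      calc _ ≤ (θ⁻¹ * ((n / N : ℕ) * θ ^ (n / N)) * 1) * C := by
            gcongr
            · exact norm_charFun_le_one t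
            · exact hdec t
        _ = _ := by rw [mul_one]
    · have h1 := pow_div_le_mul_exp hθ0 hθ2 hN n
      have h2 : ((n / N : ℕ) : ℝ) ≤ n := by exact_mod_cast Nat.div_le_self n N
      have h3 : √(n : ℝ) ≤ n := by
        rw [Real.sqrt_le_left (Nat.cast_nonneg n)]
        exact_mod_cast Nat.le_self_pow two_ne_zero n
      calc _ ≤ θ⁻¹ * (n * (θ⁻¹ * Real.exp (-(ρ * n)))) * C *
            (n : ℝ) ^ (Module.finrank ℝ E + 1) := by gcongr
        _ = θ⁻¹ * θ⁻¹ * C * ((n : ℝ) ^ (Module.finrank ℝ E + 2) * Real.exp (-(ρ * n))) := by ring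
        _ ≤ _ := by
          have := hK n
          gcongr

end Truncation

/-! ### Fourier inversion to uniform convergence, and the converse implication. -/

section LocalLimit

open scoped ENNReal ContDiff RealInnerProductSpace FourierTransform
open Complex (I)

theorem stdNormalDensity_eq_integral {d : ℕ} (y : EuclideanSpace ℝ (Fin d)) :
    (stdNormalDensity y : ℂ) = ∫ v : EuclideanSpace ℝ (Fin d),
      Complex.exp ((2 * Real.pi * ⟪v, y⟫ : ℝ) * I) *
        Complex.exp (-((‖(-(2 * Real.pi)) • v‖ : ℂ) ^ 2 / 2)) := by
  -- `2π²‖v‖²` is `‖2πv‖²/2`; evaluating at `-y` turns the transform into the inverse transform.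
  have h := fourier_gaussian_innerProductSpace (V := EuclideanSpace ℝ (Fin d))
    (b := ((2 * Real.pi ^ 2 : ℝ) : ℂ)) (by rw [Complex.ofReal_re]; positivity) (-y)
  rw [Real.fourier_eq'] at h
  have hpi : (Real.pi : ℂ) ≠ 0 := by exact_mod_cast Real.pi_ne_zero
  have h1 : (stdNormalDensity y : ℂ) = ((Real.pi : ℂ) / ((2 * Real.pi ^ 2 : ℝ) : ℂ)) ^
      ((Module.finrank ℝ (EuclideanSpace ℝ (Fin d)) : ℂ) / 2) *
      Complex.exp (-(Real.pi : ℂ) ^ 2 * (‖-y‖ : ℂ) ^ 2 / ((2 * Real.pi ^ 2 : ℝ) : ℂ)) := by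
    rw [stdNormalDensity, Complex.ofReal_mul]
    congr 1
    · have h2 : (2 * Real.pi) ^ (-((d : ℝ) / 2)) =
          (Real.pi / (2 * Real.pi ^ 2)) ^ ((d : ℝ) / 2) := by
        rw [Real.rpow_neg_eq_inv_rpow]
        congr 1
        field_simp
      rw [h2, Complex.ofReal_cpow (by positivity), finrank_euclideanSpace_fin]
      push_cast
      rfl
    · rw [Complex.ofReal_exp, norm_neg]
      congr 1
      push_cast
      field_simp
  rw [h1, ← h]
  refine integral_congr_ae (ae_of_all _ fun v => ?_)
  simp only [inner_neg_right, smul_eq_mul]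
  congr 2
  · push_cast; ring
  · rw [norm_smul, norm_neg, Real.norm_of_nonneg (by positivity)]
    push_cast; ring

theorem map_smul_measureOfDensity {d : ℕ} {r : ℝ} (hr : 0 < r)
    {q : EuclideanSpace ℝ (Fin d) → ℝ} (hq : Measurable q) :
    (measureOfDensity q).map (fun x => r⁻¹ • x) =
      measureOfDensity fun y => r ^ d * q (r • y) := by
  ext S hS
  have hm : Measurable fun x : EuclideanSpace ℝ (Fin d) => r⁻¹ • x := by fun_prop
  rw [Measure.map_apply hm hS, measureOfDensity, measureOfDensity, withDensity_apply _ (hm hS),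
    withDensity_apply _ hS, ← lintegral_indicator (hm hS), ← lintegral_indicator hS]
  have he := Measure.map_addHaar_smul (volume : Measure (EuclideanSpace ℝ (Fin d))) (r := r⁻¹)
    (inv_ne_zero hr.ne')
  have h1 : ∫⁻ y, S.indicator (fun y => ENNReal.ofReal (r ^ d * q (r • y))) y
      ∂((volume : Measure (EuclideanSpace ℝ (Fin d))).map (fun x => r⁻¹ • x)) =
      ENNReal.ofReal (r ^ d) * ∫⁻ y, S.indicator (fun y => ENNReal.ofReal (r ^ d * q (r • y))) y := by
    rw [he, lintegral_smul_measure, finrank_euclideanSpace_fin, inv_pow, inv_inv,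
      abs_of_pos (by positivity), smul_eq_mul]
  rw [lintegral_map (Measurable.indicator (by fun_prop) hS) hm] at h1
  have h2 : ∀ x, S.indicator (fun y => ENNReal.ofReal (r ^ d * q (r • y))) (r⁻¹ • x) =
      ENNReal.ofReal (r ^ d) *
        ((fun x => r⁻¹ • x) ⁻¹' S).indicator (fun x => ENNReal.ofReal (q x)) x := by
    intro x
    by_cases hx : r⁻¹ • x ∈ S
    · rw [Set.indicator_of_mem hx, Set.indicator_of_mem (by exact hx), smul_smul,
        mul_inv_cancel₀ hr.ne', one_smul, ENNReal.ofReal_mul (by positivity)]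
    · rw [Set.indicator_of_notMem hx, Set.indicator_of_notMem (by exact hx), mul_zero]
  simp_rw [h2] at h1
  rw [lintegral_const_mul' _ _ ENNReal.ofReal_ne_top] at h1
  exact (ENNReal.mul_right_inj (by simpa using pow_pos hr d) ENNReal.ofReal_ne_top).1 h1

/-- Both densities are inverse transforms, and the oscillating factor has modulus 1. The constant is
the Jacobian of `t = -2πv`. -/
theorem norm_convDensity_sub_stdNormalDensity_le {d : ℕ} {B : Measure (EuclideanSpace ℝ (Fin d))}
    [IsFiniteMeasure B] {g : EuclideanSpace ℝ (Fin d) → ℝ} (hs : ContDiff ℝ ∞ g)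
    (hc : HasCompactSupport g) (h0 : ∀ x, 0 ≤ g x) {r : ℝ} (hr : 0 < r)
    (y : EuclideanSpace ℝ (Fin d)) :
    |r ^ d * convDensity B g (r • y) - stdNormalDensity y| ≤
      ((2 * Real.pi) ^ d)⁻¹ * ∫ t : EuclideanSpace ℝ (Fin d),
        ‖charFun (B ∗ measureOfDensity g) (r⁻¹ • t) - Complex.exp (-((‖t‖ : ℂ) ^ 2 / 2))‖ := by
  have hg := hs.continuous.integrable_of_hasCompactSupport hc (μ := volume)
  have := isFiniteMeasure_measureOfDensity hg
  set c : ℝ := -(2 * Real.pi) with hcdef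
  have hc0 : c ≠ 0 := by simp [hcdef, Real.pi_ne_zero]
  set F := charFun (B ∗ measureOfDensity g) with hF
  have hFint : Integrable fun v => F (c • v) := by
    have h1 := integrable_charFun_bump hs hc h0
    simp_rw [hF, charFun_conv]
    exact h1.bdd_mul (c := B.real Set.univ)
      (by have := continuous_charFun (μ := B); fun_prop) (ae_of_all _ fun v => norm_charFun_le _)
  have hFint' : Integrable fun v => F (c • r⁻¹ • v) :=
    hFint.comp_smul (inv_ne_zero hr.ne')
  have e1 : ((r ^ d * convDensity B g (r • y) : ℝ) : ℂ) =
      ∫ v, Complex.exp ((2 * Real.pi * ⟪v, y⟫ : ℝ) * I) * F (c • r⁻¹ • v) := by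
    rw [Complex.ofReal_mul, convDensity_eq_integral_charFun hs hc h0]
    have h2 := Measure.integral_comp_smul (volume : Measure (EuclideanSpace ℝ (Fin d)))
      (fun v => Complex.exp ((2 * Real.pi * ⟪v, r • y⟫ : ℝ) * I) * F (c • v)) r⁻¹
    rw [finrank_euclideanSpace_fin, inv_pow, inv_inv, abs_of_pos (by positivity),
      Complex.real_smul] at h2
    rw [← h2]
    refine integral_congr_ae (ae_of_all _ fun v => ?_)
    simp only [inner_smul_left, inner_smul_right, conj_trivial]
    rw [← mul_assoc r r⁻¹, mul_inv_cancel₀ hr.ne', one_mul]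
  have hgint : Integrable fun v : EuclideanSpace ℝ (Fin d) =>
      Complex.exp (-((‖c • v‖ : ℂ) ^ 2 / 2)) := by
    have h1 := GaussianFourier.integrable_cexp_neg_mul_sq_norm_add
      (V := EuclideanSpace ℝ (Fin d)) (b := (1 / 2 : ℂ)) (by norm_num) 0 0
    have h2 := h1.comp_smul hc0
    refine h2.congr (ae_of_all _ fun v => ?_)
    simp only
    congr 1
    ring
  have hexp (f : EuclideanSpace ℝ (Fin d) → ℂ) (hf : Integrable f) :
      Integrable fun v => Complex.exp ((2 * Real.pi * ⟪v, y⟫ : ℝ) * I) * f v :=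
    hf.bdd_mul (c := 1) (by fun_prop) (ae_of_all _ fun v => (Complex.norm_exp_ofReal_mul_I _).le)
  rw [← Real.norm_eq_abs, ← Complex.norm_real, Complex.ofReal_sub, e1, stdNormalDensity_eq_integral,
    ← integral_sub (hexp _ hFint') (hexp _ hgint)]
  refine (norm_integral_le_integral_norm _).trans (le_of_eq ?_)
  have h3 := Measure.integral_comp_smul (volume : Measure (EuclideanSpace ℝ (Fin d)))
    (fun t => ‖F (r⁻¹ • t) - Complex.exp (-((‖t‖ : ℂ) ^ 2 / 2))‖) c
  have h4 : |(c ^ d)⁻¹| = ((2 * Real.pi) ^ d)⁻¹ := by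
    rw [abs_inv, abs_pow, hcdef, abs_neg, abs_of_pos (by positivity)]
  rw [finrank_euclideanSpace_fin, h4, smul_eq_mul] at h3
  rw [← h3]
  refine integral_congr_ae (ae_of_all _ fun v => ?_)
  simp only
  rw [← mul_sub, norm_mul, Complex.norm_exp_ofReal_mul_I, one_mul, smul_comm c r⁻¹ v]

theorem truncatedLocalLimit_of_density_le {d : ℕ} {L : ℕ → Measure (EuclideanSpace ℝ (Fin d))}
    [∀ n, IsProbabilityMeasure (L n)]
    (hL : ∀ n t, charFun (L n) t = charFun (L 1) t ^ n)
    (hexp : (fun t => charFun (L 1) t - (1 - (‖t‖ : ℂ) ^ 2 / 2)) =o[𝓝 0]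
      fun t : EuclideanSpace ℝ (Fin d) => ‖t‖ ^ 2)
    {N : ℕ} (hN : 0 < N) {g : EuclideanSpace ℝ (Fin d) → ℝ} (hs : ContDiff ℝ ∞ g)
    (hc : HasCompactSupport g)
    (h0 : ∀ x, 0 ≤ g x) {z : EuclideanSpace ℝ (Fin d)} (hz : g z ≠ 0)
    (hle : measureOfDensity g ≤ L N) :
    TruncatedLocalLimit fun n => (L n).map (fun x => (√(n : ℝ))⁻¹ • x) := by
  obtain ⟨B, R, hB, hLBR, ⟨D, ρ, hD, hρ, hR⟩, hlim⟩ :=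
    exists_truncation hL hexp hN hs hc h0 hz hle
  have hms (n : ℕ) : Measurable fun x : EuclideanSpace ℝ (Fin d) => (√(n : ℝ))⁻¹ • x := by fun_prop
  have hqm (n : ℕ) : Measurable (convDensity (B n) g) :=
    measurable_convDensity hs.continuous.measurable
  refine ⟨fun n => (B n ∗ measureOfDensity g).map (fun x => (√(n : ℝ))⁻¹ • x),
    fun n => (R n).map (fun x => (√(n : ℝ))⁻¹ • x),
    fun n y => √(n : ℝ) ^ d * convDensity (B n) g (√(n : ℝ) • y),
    fun n _ => ?_, fun n hn => ⟨?_, fun y => ?_, ?_⟩, ?_, D, ρ, hD, hρ, fun n _ => ?_⟩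
  · simp only
    rw [hLBR n, Measure.map_add _ _ (hms n)]
  · exact ((hqm n).comp (measurable_const_smul _)).const_mul _
  · exact mul_nonneg (by positivity) (convDensity_nonneg h0 _)
  · have : (0 : ℝ) < √(n : ℝ) := Real.sqrt_pos.2 (by exact_mod_cast hn)
    simp only
    rw [conv_measureOfDensity hs hc h0, map_smul_measureOfDensity this (hqm n)]
    rfl
  · rw [Metric.tendstoUniformly_iff]
    intro ε hε
    have h1 := hlim.const_mul ((2 * Real.pi) ^ d)⁻¹
    rw [mul_zero] at h1
    filter_upwards [h1.eventually_lt_const hε, eventually_ge_atTop 1] with n hn hn1 y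
    have : (0 : ℝ) < √(n : ℝ) := Real.sqrt_pos.2 (by exact_mod_cast hn1)
    rw [dist_comm, Real.dist_eq]
    exact (norm_convDensity_sub_stdNormalDensity_le hs hc h0 this y).trans_lt hn
  · rw [Measure.map_apply (hms n) MeasurableSet.univ]
    exact hR n

/-- Were `P n` singular, its absolutely continuous minorant `Q n` would vanish, so `q n` would be
zero almost everywhere. Yet once `q n` is within half the Gaussian peak, it is positive on the open
set where the Gaussian exceeds that half. -/
theorem acComponent_ne_zero_of_truncatedLocalLimit {d : ℕ}
    {P : ℕ → Measure (EuclideanSpace ℝ (Fin d))} [∀ n, IsFiniteMeasure (P n)]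
    (h : TruncatedLocalLimit P) : ∃ n : ℕ, 1 ≤ n ∧ acComponent (P n) ≠ 0 := by
  obtain ⟨Q, R, q, hPQR, hq, hlim, -⟩ := h
  have hpos : 0 < stdNormalDensity (0 : EuclideanSpace ℝ (Fin d)) := by
    rw [stdNormalDensity]; positivity
  have hcont : Continuous (stdNormalDensity (d := d)) := by
    unfold stdNormalDensity; fun_prop
  rw [Metric.tendstoUniformly_iff] at hlim
  obtain ⟨n, hn, hn1⟩ := ((hlim _ (half_pos hpos)).and (eventually_ge_atTop 1)).exists
  obtain ⟨hqm, hq0, hQ⟩ := hq n hn1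
  refine ⟨n, hn1, fun hac => ?_⟩
  have hQac : Q n ≪ volume := hQ ▸ withDensity_absolutelyContinuous _ _
  have hQP : Q n ≤ P n := by rw [hPQR n hn1]; exact Measure.le_add_right le_rfl
  have hsing : P n ⟂ₘ volume := by
    rw [acComponent] at hac
    have := Measure.haveLebesgueDecomposition_add (P n) (volume : Measure (EuclideanSpace ℝ (Fin d)))
    rw [hac, add_zero] at this
    rw [this]
    exact Measure.mutuallySingular_singularPart _ _
  have hQ0 : Q n = 0 := by
    have h1 : Q n ⟂ₘ volume := hsing.mono hQP le_rfl
    exact Measure.eq_zero_of_absolutelyContinuous_of_mutuallySingular hQac h1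
  rw [hQ, withDensity_eq_zero_iff (by fun_prop)] at hQ0
  have hopen : IsOpen {y : EuclideanSpace ℝ (Fin d) |
      stdNormalDensity (0 : EuclideanSpace ℝ (Fin d)) / 2 < stdNormalDensity y} :=
    isOpen_lt continuous_const hcont
  refine (hopen.measure_pos volume ⟨0, half_lt_self hpos⟩).ne' (measure_mono_null ?_ hQ0)
  intro y hy h2
  have h3 := hn y
  simp only [Pi.zero_apply, ENNReal.ofReal_eq_zero] at h2
  rw [Real.dist_eq] at h3
  have h4 := (abs_lt.1 h3).2
  have h5 : stdNormalDensity (0 : EuclideanSpace ℝ (Fin d)) / 2 < stdNormalDensity y := hy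
  have h6 : q n y ≤ 0 := h2
  linarith

end LocalLimit

/-! ### Undoing the normalization, second moments, and the equivalence. -/

section Main

open scoped ENNReal RealInnerProductSpace

/-- Moves the lower bound from the normalized law back to the sum itself, where convolution
corresponds to adding independent summands. -/
theorem exists_smul_restrict_le_of_map_smul {E : Type*} [NormedAddCommGroup E]
    [InnerProductSpace ℝ E] [FiniteDimensional ℝ E] [MeasurableSpace E] [BorelSpace E]
    {ν : Measure E} {r : ℝ} (hr : r ≠ 0) {A : Set E} {c : ℝ≥0∞} (hA : MeasurableSet A)
    (hA0 : volume A ≠ 0) (hfin : volume A ≠ ⊤) (h0 : c ≠ 0) (hc : c ≠ ⊤)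
    (hle : c • (volume : Measure E).restrict A ≤ ν.map (fun x => r⁻¹ • x)) :
    ∃ (A' : Set E) (c' : ℝ≥0∞), MeasurableSet A' ∧ volume A' ≠ 0 ∧ volume A' ≠ ⊤ ∧ c' ≠ 0 ∧
      c' ≠ ⊤ ∧ c' • (volume : Measure E).restrict A' ≤ ν := by
  have hm (a : ℝ) : Measurable fun x : E => a • x := by fun_prop
  have hv := Measure.addHaar_preimage_smul (volume : Measure E) (inv_ne_zero hr) A
  have hpos : 0 < |((r⁻¹) ^ Module.finrank ℝ E)⁻¹| := by positivity
  have hpos' : 0 < |(r ^ Module.finrank ℝ E)⁻¹| := by positivity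
  refine ⟨(fun x => r⁻¹ • x) ⁻¹' A, c * ENNReal.ofReal |(r ^ Module.finrank ℝ E)⁻¹|,
    hm _ hA, ?_, ?_, ?_, ENNReal.mul_ne_top hc ENNReal.ofReal_ne_top, ?_⟩
  · rw [hv]
    exact mul_ne_zero (ENNReal.ofReal_pos.2 hpos).ne' hA0
  · rw [hv]
    exact ENNReal.mul_ne_top ENNReal.ofReal_ne_top hfin
  · exact mul_ne_zero h0 (ENNReal.ofReal_pos.2 hpos').ne'
  · have h1 := Measure.map_mono hle (hm r)
    rw [Measure.map_smul, map_smul_restrict hr, smul_smul, Measure.map_map (hm _) (hm _)] at h1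
    have h2 : ((fun x : E => r • x) ∘ fun x => r⁻¹ • x) = id := by
      ext x; simp [smul_smul, mul_inv_cancel₀ hr]
    rwa [h2, Measure.map_id] at h1

theorem integral_inner_sq_of_covariance {d : ℕ} {Ω : Type*} [MeasurableSpace Ω] {μ : Measure Ω}
    [IsProbabilityMeasure μ] {X : Ω → EuclideanSpace ℝ (Fin d)} (hL2 : MemLp X 2 μ)
    (hmean : ∫ ω, X ω ∂μ = 0)
    (hcov : ∀ i j : Fin d,
      covariance (fun ω => X ω i) (fun ω => X ω j) μ = if i = j then 1 else 0)
    (t : EuclideanSpace ℝ (Fin d)) :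
    ∫ ω, ⟪X ω, t⟫ ∂μ = 0 ∧ ∫ ω, ⟪X ω, t⟫ ^ 2 ∂μ = ‖t‖ ^ 2 := by
  have h1 : ∫ ω, ⟪X ω, t⟫ ∂μ = 0 := by
    have := integral_inner (𝕜 := ℝ) (hL2.integrable (by norm_num)) t
    rw [hmean, inner_zero_right] at this
    simpa only [real_inner_comm] using this
  refine ⟨h1, ?_⟩
  have hX (i : Fin d) : MemLp (fun ω => t i * X ω i) 2 μ := by
    have : MemLp (fun ω => X ω i) 2 μ := by
      simpa [EuclideanSpace.inner_single_right] using
        hL2.inner_const (𝕜 := ℝ) (EuclideanSpace.single i (1 : ℝ))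
    exact this.const_mul _
  have hin (ω : Ω) : ⟪X ω, t⟫ = ∑ i, t i * X ω i := by
    simp [PiLp.inner_apply]
  have hae : AEMeasurable (fun ω => ⟪X ω, t⟫) μ :=
    (hL2.inner_const (𝕜 := ℝ) t).aestronglyMeasurable.aemeasurable
  -- With mean zero, the second moment is a variance, which expands bilinearly through the identity
  -- covariance matrix.
  rw [← variance_of_integral_eq_zero hae h1, ← covariance_self hae]
  simp_rw [hin]
  rw [covariance_fun_sum_fun_sum hX hX]
  simp_rw [covariance_const_mul_left, covariance_const_mul_right, hcov]
  rw [EuclideanSpace.real_norm_sq_eq]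
  simp [pow_two]

end Main

theorem mainTheorem2 {d : ℕ} {Ω : Type*} [MeasurableSpace Ω] (μ : Measure Ω)
    [IsProbabilityMeasure μ] (ξ : ℕ → Ω → EuclideanSpace ℝ (Fin d))
    (hindep : iIndepFun ξ μ)
    (hident : ∀ k, IdentDistrib (ξ k) (ξ 0) μ μ)
    (hL2 : MemLp (ξ 0) 2 μ)
    (hmean : ∫ ω, ξ 0 ω ∂μ = 0)
    (hcov : ∀ i j : Fin d,
      covariance (fun ω => ξ 0 ω i) (fun ω => ξ 0 ω j) μ = if i = j then 1 else 0) :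
    (∃ n₀ : ℕ, 1 ≤ n₀ ∧ acComponent (normalizedSumLaw μ ξ n₀) ≠ 0) ↔
      TruncatedLocalLimit (normalizedSumLaw μ ξ) := by
  have hmeas (k : ℕ) : AEMeasurable (ξ k) μ := (hident k).aemeasurable_fst
  have hSmeas (n : ℕ) : AEMeasurable (fun ω => ∑ k ∈ Finset.range n, ξ k ω) μ :=
    Finset.aemeasurable_fun_sum _ fun k _ => hmeas k
  set L : ℕ → Measure (EuclideanSpace ℝ (Fin d)) :=
    fun n => μ.map fun ω => ∑ k ∈ Finset.range n, ξ k ω with hLdef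
  have hprob (n : ℕ) : IsProbabilityMeasure (L n) := Measure.isProbabilityMeasure_map (hSmeas n)
  have hL1 : L 1 = μ.map (ξ 0) := by simp [hLdef]
  have hPL : normalizedSumLaw μ ξ = fun n => (L n).map (fun x => (√(n : ℝ))⁻¹ • x) := by
    funext n
    rw [normalizedSumLaw, hLdef]
    exact (AEMeasurable.map_map_of_aemeasurable (by fun_prop) (hSmeas n)).symm
  -- This includes `n = 0`, where `L 0` is the Dirac mass at 0; it occurs as the leftover factor
  -- when `N` divides `n`.
  have hL (n : ℕ) (t) : charFun (L n) t = charFun (L 1) t ^ n := by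
    rw [hL1, hLdef]
    simp only
    rw [(hindep.restrict _).charFun_map_fun_finsetSum_eq_prod (fun k _ => hmeas k)]
    simp [fun k => (hident k).map_eq]
  constructor
  · rintro ⟨n₀, hn₀, hac⟩
    have hr : √(n₀ : ℝ) ≠ 0 := (Real.sqrt_pos.2 (by exact_mod_cast hn₀)).ne'
    obtain ⟨A, c, hA, hA0, hAfin, hc0, hc, hle⟩ :=
      exists_smul_restrict_le_withDensity (Measure.measurable_rnDeriv _ _) hac
    have hle' := hle.trans (Measure.withDensity_rnDeriv_le _ _)
    rw [hPL] at hle'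
    obtain ⟨A', c', hA', hA0', hAfin', hc0', hc', hle''⟩ :=
      exists_smul_restrict_le_of_map_smul hr hA hA0 hAfin hc0 hc hle'
    obtain ⟨g, hs, hcs, hg0, ⟨z, hz⟩, hgle⟩ :=
      exists_contDiff_withDensity_le_conv hA' hA0' hAfin' hc0' hc' hle''
    have hconv : L n₀ ∗ L n₀ = L (n₀ + n₀) := by
      refine Measure.ext_of_charFun (funext fun t => ?_)
      rw [charFun_conv, hL n₀, hL (n₀ + n₀), pow_add]
    rw [hconv] at hgle
    have hexp := charFun_sub_isLittleO (μ := L 1)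
      (by rw [hL1]; exact (memLp_map_measure_iff (by fun_prop) (hmeas 0)).2 hL2)
      (fun t => by
        rw [hL1, integral_map (hmeas 0) (by fun_prop)]
        exact (integral_inner_sq_of_covariance hL2 hmean hcov t).1)
      (fun t => by
        rw [hL1, integral_map (hmeas 0) (by fun_prop)]
        exact (integral_inner_sq_of_covariance hL2 hmean hcov t).2)
    rw [hPL]
    exact truncatedLocalLimit_of_density_le hL hexp (by omega) hs hcs hg0 hz hgle
  · intro h
    have hfin (n : ℕ) : IsFiniteMeasure (normalizedSumLaw μ ξ n) := by
      rw [normalizedSumLaw]; infer_instance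
    exact acComponent_ne_zero_of_truncatedLocalLimit h
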